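/- Let $G$ be a group, with profinite completion $\hat G=\varprojlim G/N$, where $N$ runs over the normal subgroups of finite index. Regard $G$ as a discrete group and $\hat G$ as a topological group with the inverse limit topology. A finite $G$-module is a finite discrete abelian group $M$ with an action of $G$ by automorphisms; since $G\to\operatorname{Aut}(M)$ factors over $\hat G$, such an $M$ is also a $\hat G$-module. The group $G$ is called good if, for every integer $p\ge 0$ and every finite $G$-module $M$, the restriction map $H^p(\hat G,M)\to H^p(G,M)$ on cohomology, defined by continuous cochains, is bijective. For $r>0$, the exact sequence $1\to\mathbb{C}^\times\to \mathrm{GL}_r(\mathbb{C})\to \mathrm{PGL}_r(\mathbb{C})\to 1$ of groups with trivial $G$-action induces the nonabelian coboundary map $H^1(G,\mathrm{PGL}_r(\mathbb{C}))\to H^2(G,\mathbb{C}^\times)$: it sends the class of a homomorphism $\varphi:G\to\mathrm{PGL}_r(\mathbb{C})$ to the class of the $2$-cocycle $(g,h)\mapsto P(g)P(h)P(gh)^{-1}\in\mathbb{C}^\times$, where $P:G\to\mathrm{GL}_r(\mathbb{C})$ is any map lifting $\varphi$. Proposition. Let $G$ be a good group. Then for every torsion class $\beta\in H^2(G,\mathbb{C}^\times)$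 there is an integer $r>0$ such that $\beta$ lies in the image of the coboundary map $H^1(G,\mathrm{PGL}_r(\mathbb{C}))\to H^2(G,\mathbb{C}^\times)$. -/

import Mathlib

open CategoryTheory
open scoped MatrixGroups

namespace GoodGroup

universe u

noncomputable section

/-! ### Good groups in the sense of Serre -/

section Good

variable (G : Type u) [Group G]

/-- The profinite completion `Ĝ = lim G ⧸ N`, the limit running over all normal subgroups `N` of
finite index, with the limit topology. -/
abbrev Completion : ProfiniteGrp.{u} :=
  ProfiniteGrp.ProfiniteCompletion.completion (GrpCat.of G)

/-- The canonical homomorphism `G → Ĝ`. -/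
def toCompletion : G →* Completion G :=
  (ProfiniteGrp.ProfiniteCompletion.eta (GrpCat.of G)).hom

/-- The projection `Ĝ → G ⧸ N` for a normal subgroup `N` of finite index. -/
def completionProj (N : FiniteIndexNormalSubgroup G) : Completion G →* G ⧸ N.toSubgroup where
  toFun x := x.1 N
  map_one' := rfl
  map_mul' _ _ := rfl

variable (M : Type u) [AddCommGroup M] [DistribMulAction G M]

/-- The homomorphism `G → Aut(M)` given by a `G`-module `M`. -/
abbrev actionHom : G →* (M ≃ₗ[ℤ] M) := DistribMulAction.toModuleAut ℤ M

variable [Finite M]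

/-- The kernel of `G → Aut(M)`; it has finite index when `M` is finite. -/
def actionKer : FiniteIndexNormalSubgroup G :=
  haveI : Finite (M ≃ₗ[ℤ] M) := DFunLike.finite (M ≃ₗ[ℤ] M)
  haveI : (actionHom G M).ker.FiniteIndex := Subgroup.finiteIndex_ker _
  FiniteIndexNormalSubgroup.ofSubgroup (actionHom G M).ker

/-- The factorization `Ĝ → G ⧸ ker → Aut(M)` of `G → Aut(M)` over the profinite completion. -/
def completionActionHom : Completion G →* (M ≃ₗ[ℤ] M) :=
  (QuotientGroup.kerLift (actionHom G M)).comp (completionProj G (actionKer G M))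

lemma completionActionHom_toCompletion (g : G) :
    completionActionHom G M (toCompletion G g) = actionHom G M g := rfl

variable [TopologicalSpace M] [DiscreteTopology M]

/-- A discrete abelian group with an action of a group `Γ` by automorphisms, as an object of
Mathlib's category of topological `ℤ`-linear representations of `Γ`. -/
abbrev discreteRep {Γ : Type u} [Group Γ] {V : Type u} [AddCommGroup V] [TopologicalSpace V]
    [DiscreteTopology V] (ρ : Γ →* (V ≃ₗ[ℤ] V)) : TopRep.{u} ℤ Γ :=
  TopRep.of (X := V) (ContRepresentation.ofMonoidHom
    { toFun := fun g => ⟨(ρ g).toLinearMap, continuous_of_discreteTopology⟩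
      map_one' := by ext m; simp
      map_mul' := fun g h => by ext m; simp })

variable [TopologicalSpace G] [DiscreteTopology G]

/-- The canonical homomorphism `G → Ĝ`, continuous because `G` is discrete. -/
def toCompletionCont : G →ₜ* Completion G where
  __ := toCompletion G
  continuous_toFun := continuous_of_discreteTopology

/-- The identity of `M`, as a morphism from the `Ĝ`-module `M` restricted to `G` to the
`G`-module `M`. -/
def resToModule :
    TopRep.res (toCompletionCont G : G →* Completion G) (discreteRep (completionActionHom G M)) ⟶
      discreteRep (actionHom G M) :=
  TopRep.ofHom ⟨ContinuousLinearMap.id ℤ M, fun _ => rfl⟩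

/-- The restriction map `Hᵖ(Ĝ, M) → Hᵖ(G, M)` on continuous cohomology, for a finite
`G`-module `M`. -/
def restriction (p : ℕ) :
    continuousCohomology.{0, u, u} p (discreteRep (completionActionHom G M)) ⟶
      continuousCohomology.{0, u, u} p (discreteRep (actionHom G M)) :=
  ContinuousCohomology.map (toCompletionCont G) (resToModule G M) p

end Good

/-- A group `G`, regarded as a discrete topological group, is *good* if for all finite (discrete)
`G`-modules `M` and all `p ≥ 0` the restriction map `Hᵖ(Ĝ, M) → Hᵖ(G, M)` is bijective. -/
def IsGood (G : Type u) [Group G] : Prop :=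
  letI : TopologicalSpace G := ⊥
  haveI : DiscreteTopology G := ⟨rfl⟩
  ∀ (M : Type u) [AddCommGroup M] [DistribMulAction G M] [Finite M] [TopologicalSpace M]
    [DiscreteTopology M] (p : ℕ), Function.Bijective (restriction G M p)

/-! ### The nonabelian coboundary map -/

section Coboundary

variable (G : Type u) [Group G]

/-- The trivial `G`-module `ℂˣ`, written additively. (The `ULift`s only adjust universes.) -/
abbrev trivialCx : Rep.{u} (ULift.{u} ℤ) G :=
  Rep.trivial (ULift.{u} ℤ) G (ULift.{u} (Additive ℂˣ))

/-- `H²(G, ℂˣ)` for the trivial action, with the group law written additively. -/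
abbrev H2Cx : Type u := groupCohomology.H2 (trivialCx G)

/-- A function `G × G → ℂˣ` as a 2-cochain with values in the trivial module `ℂˣ`. -/
def toCochain (c : G × G → ℂˣ) : G × G → trivialCx G := fun p => ULift.up (Additive.ofMul (c p))

/-- For a group `A` with trivial `G`-action a 1-cocycle `φ(gh) = φ(g) · ᵍφ(h)` is a homomorphism
`G → A`, and two of them are cohomologous if `ψ(g) = a⁻¹ · φ(g) · ᵍa` for some `a : A`. -/
def cohomologous (A : Type*) [Group A] : Setoid (G →* A) where
  r φ ψ := ∃ a : A, ∀ g, ψ g = a⁻¹ * φ g * a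
  iseqv :=
    { refl := fun φ => ⟨1, fun g => by simp⟩
      symm := by
        rintro φ ψ ⟨a, h⟩
        exact ⟨a⁻¹, fun g => by rw [h]; group⟩
      trans := by
        rintro φ ψ χ ⟨a, h⟩ ⟨b, k⟩
        exact ⟨a * b, fun g => by rw [k, h]; group⟩ }

/-- The nonabelian cohomology set `H¹(G, A)` of a group `A` with trivial `G`-action. -/
def NonabH1 (A : Type*) [Group A] := Quotient (cohomologous G A)

variable {G} {r : ℕ}

/-- `c` is the obstruction cochain of the map `P : G → GL_r(ℂ)`:
`P(g) P(h) P(gh)⁻¹ = c(g, h)`, a scalar matrix. -/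
def IsFactorSet (P : G → GL (Fin r) ℂ) (c : G × G → ℂˣ) : Prop :=
  ∀ g h, P g * P h * (P (g * h))⁻¹ = Matrix.GeneralLinearGroup.scalar (Fin r) (c (g, h))

lemma exists_isFactorSet (φ : G →* PGL(r, ℂ)) (P : G → GL (Fin r) ℂ)
    (hP : ∀ g, Matrix.ProjGenLinGroup.mk (P g) = φ g) : ∃ c, IsFactorSet P c := by
  have key : ∀ p : G × G, ∃ u : ℂˣ,
      P p.1 * P p.2 * (P (p.1 * p.2))⁻¹ = Matrix.GeneralLinearGroup.scalar (Fin r) u := by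
    intro p
    have h1 : Matrix.ProjGenLinGroup.mk (1 : GL (Fin r) ℂ)
        = Matrix.ProjGenLinGroup.mk (P p.1 * P p.2 * (P (p.1 * p.2))⁻¹) := by
      simp [hP]
    obtain ⟨u, hu⟩ := Matrix.ProjGenLinGroup.mk_eq_mk_iff.1 h1
    exact ⟨u, by rw [← hu, one_mul]⟩
  choose c hc using key
  exact ⟨c, fun g h => hc (g, h)⟩

lemma scalar_comm (u : ℂˣ) (A : GL (Fin r) ℂ) :
    Matrix.GeneralLinearGroup.scalar (Fin r) u * A
      = A * Matrix.GeneralLinearGroup.scalar (Fin r) u := by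
  have h : Matrix.GeneralLinearGroup.scalar (Fin r) u ∈ Subgroup.center (GL (Fin r) ℂ) := by
    rw [Matrix.GeneralLinearGroup.center_eq_range_scalar]
    exact ⟨u, rfl⟩
  exact (Subgroup.mem_center_iff.1 h A).symm

lemma scalar_inj [NeZero r] {u v : ℂˣ}
    (h : Matrix.GeneralLinearGroup.scalar (Fin r) u = Matrix.GeneralLinearGroup.scalar (Fin r) v) :
    u = v := by
  have h0 := congrArg (fun A : GL (Fin r) ℂ => (A : Matrix (Fin r) (Fin r) ℂ) 0 0) h
  ext
  simpa using h0

lemma IsFactorSet.mul_eq {P : G → GL (Fin r) ℂ} {c : G × G → ℂˣ} (hc : IsFactorSet P c)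
    (g h : G) : P g * P h = Matrix.GeneralLinearGroup.scalar (Fin r) (c (g, h)) * P (g * h) := by
  rw [← hc g h]; group

lemma IsFactorSet.mem_cocycles [NeZero r] {P : G → GL (Fin r) ℂ} {c : G × G → ℂˣ}
    (hc : IsFactorSet P c) : toCochain G c ∈ groupCohomology.cocycles₂ (trivialCx G) := by
  rw [groupCohomology.mem_cocycles₂_iff]
  intro g h j
  have key : c (g * h, j) * c (g, h) = c (h, j) * c (g, h * j) := by
    apply scalar_inj (r := r)
    have e1 : P g * P h * P j = Matrix.GeneralLinearGroup.scalar (Fin r) (c (g, h)) *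
        Matrix.GeneralLinearGroup.scalar (Fin r) (c (g * h, j)) * P (g * h * j) := by
      rw [hc.mul_eq g h, mul_assoc, hc.mul_eq (g * h) j, ← mul_assoc]
    have e2 : P g * P h * P j = Matrix.GeneralLinearGroup.scalar (Fin r) (c (h, j)) *
        Matrix.GeneralLinearGroup.scalar (Fin r) (c (g, h * j)) * P (g * h * j) := by
      rw [mul_assoc, hc.mul_eq h j, ← mul_assoc, ← scalar_comm, mul_assoc, hc.mul_eq g (h * j),
        mul_assoc, mul_assoc]
    have e3 := mul_right_cancel (e1.symm.trans e2)
    rw [map_mul, map_mul, ← e3, scalar_comm]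
  exact congrArg (fun x : ℂˣ => ULift.up (Additive.ofMul x)) key

/-- The class in `H²(G, ℂˣ)` of the obstruction cochain of `P`. -/
def IsFactorSet.class [NeZero r] {P : G → GL (Fin r) ℂ} {c : G × G → ℂˣ}
    (hc : IsFactorSet P c) : H2Cx G :=
  groupCohomology.H2π (trivialCx G) ⟨toCochain G c, hc.mem_cocycles⟩

/-- The class depends neither on the choice of the lift nor on the 1-cocycle in its class. -/
lemma IsFactorSet.class_eq [NeZero r] {P Q : G → GL (Fin r) ℂ} {c d : G × G → ℂˣ}
    (hc : IsFactorSet P c) (hd : IsFactorSet Q d) (φ ψ : G →* PGL(r, ℂ))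
    (hP : ∀ g, Matrix.ProjGenLinGroup.mk (P g) = φ g)
    (hQ : ∀ g, Matrix.ProjGenLinGroup.mk (Q g) = ψ g)
    (h : (cohomologous G (PGL(r, ℂ))).r φ ψ) : hc.class = hd.class := by
  obtain ⟨a, ha⟩ := h
  obtain ⟨A, rfl⟩ := Matrix.ProjGenLinGroup.mk_surjective a
  have hx : ∀ g, ∃ u : ℂˣ,
      Q g * Matrix.GeneralLinearGroup.scalar (Fin r) u = A⁻¹ * P g * A := by
    intro g
    apply Matrix.ProjGenLinGroup.mk_eq_mk_iff.1
    simp [hP, hQ, ha]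
  choose x hx using hx
  refine (groupCohomology.H2π_eq_iff _ _).2 ?_
  refine ⟨fun g => ULift.up (Additive.ofMul (x g)), ?_⟩
  have key : ∀ g h, x h / x (g * h) * x g = c (g, h) / d (g, h) := by
    intro g h
    rw [div_mul_eq_mul_div, div_eq_div_iff_mul_eq_mul]
    apply scalar_inj (r := r)
    let S : ℂˣ →* GL (Fin r) ℂ := Matrix.GeneralLinearGroup.scalar (Fin r)
    change ∀ g, Q g * S (x g) = A⁻¹ * P g * A at hx
    have e1 : (Q g * S (x g)) * (Q h * S (x h)) = S (c (g, h)) * (Q (g * h) * S (x (g * h))) := by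
      rw [hx, hx, hx]
      calc A⁻¹ * P g * A * (A⁻¹ * P h * A) = A⁻¹ * (P g * P h) * A := by group
        _ = A⁻¹ * S (c (g, h)) * P (g * h) * A := by rw [hc.mul_eq g h]; simp only [mul_assoc]; rfl
        _ = S (c (g, h)) * (A⁻¹ * P (g * h) * A) := by rw [← scalar_comm]; simp only [mul_assoc]; rfl
    have e2 : (Q g * S (x g)) * (Q h * S (x h)) = S (x h * x g * d (g, h)) * Q (g * h) := by
      calc (Q g * S (x g)) * (Q h * S (x h)) = S (x h) * (S (x g) * (Q g * Q h)) := by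
            rw [← scalar_comm, ← scalar_comm (x h), mul_assoc, ← mul_assoc (Q g),
              ← scalar_comm (x h) (Q g)]
            simp only [← mul_assoc]
            rw [← scalar_comm (x g) (S (x h))]
        _ = _ := by rw [hd.mul_eq g h]; simp only [map_mul, mul_assoc]; rfl
    refine mul_right_cancel (b := Q (g * h)) ?_
    rw [← e2, e1, ← scalar_comm, map_mul, mul_assoc]
  funext p
  obtain ⟨g, h⟩ := p
  exact congrArg (fun x : ℂˣ => ULift.up (Additive.ofMul x)) (key g h)

variable (G r)

/-- The coboundary map `H¹(G, PGL_r(ℂ)) → H²(G, ℂˣ)` of the extension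
`1 → ℂˣ → GL_r(ℂ) → PGL_r(ℂ) → 1` of groups with trivial `G`-action: choose a lift
`P : G → GL_r(ℂ)` of a 1-cocycle `φ : G → PGL_r(ℂ)` and take the class of the 2-cocycle
`(g, h) ↦ P(g) P(h) P(gh)⁻¹`. -/
def coboundary [NeZero r] : NonabH1 G (PGL(r, ℂ)) → H2Cx G :=
  Quotient.lift
    (fun φ : G →* PGL(r, ℂ) => (exists_isFactorSet φ _
      (fun g => Function.surjInv_eq Matrix.ProjGenLinGroup.mk_surjective (φ g))).choose_spec.class)
    (fun φ ψ h => IsFactorSet.class_eq _ _ φ ψ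
      (fun g => Function.surjInv_eq Matrix.ProjGenLinGroup.mk_surjective (φ g))
      (fun g => Function.surjInv_eq Matrix.ProjGenLinGroup.mk_surjective (ψ g)) h)

variable {G r}

/-- The coboundary map may be computed with any lift of any representing 1-cocycle. -/
lemma coboundary_mk [NeZero r] (φ : G →* PGL(r, ℂ)) {P : G → GL (Fin r) ℂ}
    (hP : ∀ g, Matrix.ProjGenLinGroup.mk (P g) = φ g) {c : G × G → ℂˣ} (hc : IsFactorSet P c) :
    coboundary G r (Quotient.mk (cohomologous G (PGL(r, ℂ))) φ) = hc.class :=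
  IsFactorSet.class_eq (exists_isFactorSet φ _ fun g =>
      Function.surjInv_eq Matrix.ProjGenLinGroup.mk_surjective (φ g)).choose_spec hc φ φ
    (fun g => Function.surjInv_eq Matrix.ProjGenLinGroup.mk_surjective (φ g)) hP
    ((cohomologous G (PGL(r, ℂ))).refl φ)

end Coboundary

end

end GoodGroup

/-! Suppose `n • β = 0` with `n > 0`. Since `ℂˣ` is divisible, `β` comes from a class in `H²(G,
μ_n)`, where `μ_n` is the finite trivial module of `n`-th roots of unity
(`exists_rootsOfUnity_cochain`). Surjectivity of restriction in degree 2 makes that class, up to a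
coboundary, the restriction of a continuous cochain on the compact group `Ĝ`
(`IsGood.exists_continuous_cochain`). Such a cochain with discrete values is unchanged by
translations from an open normal subgroup, so `β` has a representing cocycle `c` with `c(g, hu) =
c(g, h)` for all `u` in a normal subgroup `N` of finite index (`IsGood.exists_factors`).

This one-sided invariance suffices to define `P(g) e_{hN} = c(g, h) e_{ghN}` on the space with basis
`G ⧸ N`. The cocycle identity says exactly that `P(g) P(h) = c(g, h) P(gh)`, so `β` is the
coboundary of a homomorphism to `PGL_r(ℂ)` with `r = [G : N]` (`exists_isFactorSet_of_factors`). -/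

/-! ### Cycles and homology of topological modules in terms of elements. -/

namespace TopModuleCat

variable {R : Type*} [Ring R] [TopologicalSpace R]

/-- The left homology data given by the explicit kernels and cokernels in `TopModuleCat R`. -/
noncomputable def leftHomologyData (S : ShortComplex (TopModuleCat R)) : S.LeftHomologyData :=
  ⟨_, _, _, _, _, isLimitKer _, by simp, isColimitCoker _⟩

variable {S : ShortComplex (TopModuleCat R)}

/-- The abstract cycles are isomorphic to the explicit kernel, whose elements are known; the next
two lemmas use the explicit cokernel likewise. -/
lemma exists_iCycles_eq (x : S.X₂) (hx : S.g.hom x = 0) :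
    ∃ z : S.cycles, S.iCycles.hom z = x := by
  refine ⟨(leftHomologyData S).cyclesIso.inv.hom ⟨x, hx⟩, ?_⟩
  have h := (leftHomologyData S).cyclesIso_inv_comp_iCycles
  exact congrArg (fun f => f.hom (⟨x, hx⟩ : S.g.hom.ker)) h

lemma homologyπ_surjective : Function.Surjective S.homologyπ.hom := by
  intro y
  have h := (leftHomologyData S).π_comp_homologyIso_inv
  obtain ⟨w, hw⟩ := Submodule.mkQ_surjective _ ((leftHomologyData S).homologyIso.hom.hom y)
  refine ⟨(leftHomologyData S).cyclesIso.inv.hom w, ?_⟩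
  have h1 := congrArg (fun f => f.hom w) h
  have h2 := congrArg (fun f => f.hom y) (leftHomologyData S).homologyIso.hom_inv_id
  refine h1.symm.trans (Eq.trans ?_ h2)
  exact congrArg (leftHomologyData S).homologyIso.inv.hom hw

lemma exists_eq_iCycles_of_homologyπ_eq_zero (z : S.cycles) (hz : S.homologyπ.hom z = 0) :
    ∃ y : S.X₁, S.f.hom y = S.iCycles.hom z := by
  have h := (leftHomologyData S).homologyπ_comp_homologyIso_hom
  have h1 := congrArg (fun f => f.hom z) h
  have h2 : (leftHomologyData S).homologyIso.hom.hom (S.homologyπ.hom z) = 0 := by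
    rw [hz, map_zero]
  have h3 := h1.symm.trans h2
  obtain ⟨y, hy⟩ := (Submodule.Quotient.mk_eq_zero _).1 h3
  refine ⟨y, ?_⟩
  have h4 := congrArg (fun f => f.hom y) (leftHomologyData S).f'_i
  have h5 := congrArg (fun f => f.hom z) (leftHomologyData S).cyclesIso_hom_comp_i
  refine h4.symm.trans (Eq.trans ?_ h5)
  exact congrArg (leftHomologyData S).i.hom hy

end TopModuleCat

namespace HomologicalComplex

variable {R : Type*} [Ring R] [TopologicalSpace R] {ι : Type*} {c : ComplexShape ι}
  (K : HomologicalComplex (TopModuleCat R) c)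

lemma exists_iCycles_eq_of_d_eq_zero {i j : ι} (hij : c.Rel i j) (x : K.X i)
    (hx : (K.d i j).hom x = 0) : ∃ z : K.cycles i, (K.iCycles i).hom z = x := by
  obtain rfl := c.next_eq' hij
  exact TopModuleCat.exists_iCycles_eq (S := K.sc i) x hx

lemma d_iCycles_apply {i j : ι} (z : K.cycles i) : (K.d i j).hom ((K.iCycles i).hom z) = 0 :=
  congrArg (fun f => f.hom z) (K.iCycles_d i j)

lemma exists_d_eq_of_homologyπ_eq {i j : ι} (hij : c.Rel i j) (z w : K.cycles j)
    (h : (K.homologyπ j).hom z = (K.homologyπ j).hom w) :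
    ∃ y : K.X i, (K.d i j).hom y = (K.iCycles j).hom z - (K.iCycles j).hom w := by
  obtain rfl := c.prev_eq' hij
  obtain ⟨y, hy⟩ := TopModuleCat.exists_eq_iCycles_of_homologyπ_eq_zero (S := K.sc j) (z - w)
    ((map_sub (K.homologyπ j).hom z w).trans (sub_eq_zero.2 h))
  exact ⟨y, hy.trans (map_sub (K.iCycles j).hom z w)⟩

/-- A chain map inducing a surjection on homology hits every cocycle up to a coboundary. -/
lemma exists_map_sub_eq_d {K L : HomologicalComplex (TopModuleCat R) c} (f : K ⟶ L) {i j k : ι}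
    (hij : c.Rel i j) (hjk : c.Rel j k)
    (hf : Function.Surjective (homologyMap f j)) (x : L.X j) (hx : (L.d j k).hom x = 0) :
    ∃ (y : K.X j) (e : L.X i), (K.d j k).hom y = 0 ∧ (L.d i j).hom e = x - (f.f j).hom y := by
  obtain ⟨z, rfl⟩ := L.exists_iCycles_eq_of_d_eq_zero hjk x hx
  obtain ⟨w, hw⟩ := hf ((L.homologyπ j).hom z)
  obtain ⟨v, rfl⟩ := TopModuleCat.homologyπ_surjective (S := K.sc j) w
  have h1 := congrArg (fun f => f.hom v) (homologyπ_naturality f j)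
  obtain ⟨e, he⟩ := L.exists_d_eq_of_homologyπ_eq hij z ((cyclesMap f j).hom v)
    (hw.symm.trans h1)
  have h2 := congrArg (fun f => f.hom v) (cyclesMap_i f j)
  refine ⟨(K.iCycles j).hom v, e, K.d_iCycles_apply v, he.trans ?_⟩
  exact congrArg _ h2

end HomologicalComplex

/-! ### Goodness in degree 2, on the level of cochains. -/

namespace GoodGroup

universe u

variable {G : Type u} [Group G]

/-- The homogeneous cochain `(x, y, z) ↦ c(x⁻¹y, y⁻¹z)` on a discrete group attached to `c`. -/
def homogeneousOf {M : Type*} [TopologicalSpace M] [TopologicalSpace G] [DiscreteTopology G]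
    (c : G → G → M) : C(G, C(G, C(G, M))) :=
  ⟨fun x => ⟨fun y => ⟨fun z => c (x⁻¹ * y) (y⁻¹ * z), continuous_of_discreteTopology⟩,
    continuous_of_discreteTopology⟩, continuous_of_discreteTopology⟩

/-- Over a good group, a 2-cocycle with values in a finite trivial module is, up to a coboundary,
the restriction of a continuous 2-cochain on the profinite completion. -/
theorem IsGood.exists_continuous_cochain (hG : IsGood G) {M : Type u} [AddCommGroup M] [Finite M]
    [TopologicalSpace M] [DiscreteTopology M] (c : G → G → M)
    (hc : ∀ g h j, c (g * h) j + c g h = c h j + c g (h * j)) :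
    ∃ (F : C(Completion G, C(Completion G, C(Completion G, M)))) (e : G → M), ∀ g h,
      e h - e (g * h) + e g = c g h - F 1 (toCompletion G g) (toCompletion G (g * h)) := by
  let : TopologicalSpace G := ⊥
  have : DiscreteTopology G := ⟨rfl⟩
  let : DistribMulAction G M :=
    { smul := fun _ m => m
      one_smul := fun _ => rfl
      mul_smul := fun _ _ _ => rfl
      smul_zero := fun _ => rfl
      smul_add := fun _ _ _ => rfl }
  -- Homogeneous cochains of degree 2 have three variables, hence the index 3.
  have hinv : homogeneousOf c ∈
      (TopRep.resolutionX.{0, u, u} (discreteRep.{u} (actionHom G M)) 3).ρ.invariants := by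
    refine (ContRepresentation.mem_invariants _).2 fun g => ?_
    refine ContinuousMap.ext fun x => ContinuousMap.ext fun y => ContinuousMap.ext fun z => ?_
    change c ((g⁻¹ * x)⁻¹ * (g⁻¹ * y)) ((g⁻¹ * y)⁻¹ * (g⁻¹ * z)) = c (x⁻¹ * y) (y⁻¹ * z)
    congr 1 <;> group
  obtain ⟨F, E, -, hE⟩ := HomologicalComplex.exists_map_sub_eq_d
    (ContinuousCohomology.cochainsMap (toCompletionCont G) (resToModule G M))
    (i := 1) (j := 2) (k := 3) rfl rfl (hG M 2).2 ⟨homogeneousOf c, hinv⟩ (by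
      refine Subtype.ext ((TopRep.homogeneousCochains.d_apply _ 2 _).trans ?_)
      refine ContinuousMap.ext fun x => ContinuousMap.ext fun y => ContinuousMap.ext fun z =>
        ContinuousMap.ext fun w => ?_
      -- The homogeneous differential of the cochain is the cocycle identity at `(x⁻¹y, y⁻¹z,
      -- z⁻¹w)`.
      change c (y⁻¹ * z) (z⁻¹ * w) - (c (x⁻¹ * z) (z⁻¹ * w) - (c (x⁻¹ * y) (y⁻¹ * w) -
        c (x⁻¹ * y) (y⁻¹ * z))) = 0
      have := hc (x⁻¹ * y) (y⁻¹ * z) (z⁻¹ * w)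
      simp only [mul_assoc, mul_inv_cancel_left] at this
      refine Eq.trans ?_ (sub_eq_zero.2 this.symm)
      abel)
  have hE1 := (TopRep.homogeneousCochains.d_apply _ 1 E).symm.trans (congrArg Subtype.val hE)
  let E' : C(G, C(G, M)) := E.1
  let F' : C(Completion G, C(Completion G, C(Completion G, M))) := F.1
  have hE2 : ∀ x y z, E' y z - (E' x z - E' x y) = c (x⁻¹ * y) (y⁻¹ * z) -
      F' (toCompletion G x) (toCompletion G y) (toCompletion G z) := fun x y z =>
    congrArg (fun f : C(G, C(G, C(G, M))) => f x y z) hE1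
  have hEi : ∀ g x y, E' (g⁻¹ * x) (g⁻¹ * y) = E' x y := fun g x y =>
    congrArg (fun f : C(G, C(G, M)) => f x y) ((ContRepresentation.mem_invariants _).1 E.2 g)
  refine ⟨F', fun g => E' 1 g, fun g h => ?_⟩
  -- Dehomogenize at `(1, g, gh)`; invariance turns `E'(g, gh)` into `E'(1, h)`.
  have h1 := hE2 1 g (g * h)
  rw [← hEi g g (g * h)] at h1
  simp only [inv_mul_cancel, inv_mul_cancel_left, inv_one, one_mul, map_one] at h1
  rw [← h1]
  abel

end GoodGroup

/-! ### Uniform local constancy on profinite groups. -/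

/-- A continuous function on the product of a compact space with a profinite group, with values
in a discrete space, is invariant under translation by an open normal subgroup. -/
theorem ProfiniteGrp.exists_openNormalSubgroup_mul_invariant {Γ : ProfiniteGrp} {X M : Type*}
    [TopologicalSpace X] [CompactSpace X] [TopologicalSpace M] [DiscreteTopology M]
    {f : X × Γ → M} (hf : Continuous f) :
    ∃ U : OpenNormalSubgroup Γ, ∀ x y, ∀ u ∈ U, f (x, y * u) = f (x, y) := by
  have hopen : IsOpen {q : Γ × (X × Γ) | f (q.2.1, q.2.2 * q.1) = f q.2} := by
    have h1 : Continuous (fun q : Γ × (X × Γ) => (f (q.2.1, q.2.2 * q.1), f q.2)) := by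
      fun_prop
    exact (isOpen_discrete {m : M × M | m.1 = m.2}).preimage h1
  -- The open set contains `{1} × (X × Γ)`, so by compactness it contains a tube `s × (X × Γ)`
  -- around it.
  obtain ⟨s, t, hs, -, h1s, ht, hst⟩ := generalized_tube_lemma (s := {(1 : Γ)})
    isCompact_singleton (t := (Set.univ : Set (X × Γ))) isCompact_univ hopen
    (by rintro ⟨a, b⟩ ⟨rfl, -⟩; simp)
  obtain ⟨U, hU⟩ := ProfiniteGrp.exist_openNormalSubgroup_sub_open_nhds_of_one hs (h1s rfl)
  exact ⟨U, fun x y u hu => hst (Set.mk_mem_prod (hU hu) (ht (Set.mem_univ (x, y))))⟩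

/-! ### The twisted regular representation. -/

namespace GoodGroup

universe u

variable {G : Type u} [Group G]

/-- The permutation matrix of `σ`, rescaled by the units `d`, is invertible. -/
noncomputable def monomial {n : Type*} [Fintype n] [DecidableEq n] (σ : Equiv.Perm n)
    (d : n → ℂˣ) : GL n ℂ where
  val := Matrix.of fun i j => if i = σ j then (d j : ℂ) else 0
  inv := Matrix.of fun i j => if j = σ i then ((d i)⁻¹ : ℂˣ) else 0
  val_inv := by
    ext i j
    obtain ⟨i, rfl⟩ := σ.surjective i
    obtain ⟨j, rfl⟩ := σ.surjective j
    rcases eq_or_ne i j with rfl | h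
    · simp [Matrix.mul_apply]
    · simp [Matrix.mul_apply, h]
  inv_val := by
    ext i j
    rcases eq_or_ne i j with rfl | h
    · simp [Matrix.mul_apply]
    · simp [Matrix.mul_apply, h, h.symm]

lemma monomial_mul {n : Type*} [Fintype n] [DecidableEq n] (σ τ : Equiv.Perm n) (d e : n → ℂˣ) :
    monomial σ d * monomial τ e = monomial (σ * τ) (fun j => d (τ j) * e j) := by
  ext i j
  simp [monomial, Matrix.mul_apply]
  congr

lemma scalar_mul_monomial {n : Type*} [Fintype n] [DecidableEq n] (u : ℂˣ) (σ : Equiv.Perm n)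
    (d : n → ℂˣ) :
    Matrix.GeneralLinearGroup.scalar n u * monomial σ d = monomial σ (fun j => u * d j) := by
  ext i j
  simp [monomial, Matrix.GeneralLinearGroup.coe_scalar]

/-- The twisted regular representation: a 2-cocycle of `G` which only depends on classes modulo
a normal subgroup of finite index is a factor set. -/
theorem exists_isFactorSet_of_factors (N : Subgroup G) [N.Normal] [N.FiniteIndex]
    (c : G × G → ℂˣ)
    (hc : ∀ g h j, c (g * h, j) * c (g, h) = c (h, j) * c (g, h * j))
    (hN : ∀ g h, ∀ u ∈ N, c (g, h * u) = c (g, h)) :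
    ∃ (r : ℕ) (_ : NeZero r) (φ : G →* PGL(r, ℂ)) (P : G → GL (Fin r) ℂ),
      (∀ g, Matrix.ProjGenLinGroup.mk (P g) = φ g) ∧ IsFactorSet P c := by
  let r := Nat.card (G ⧸ N)
  have : NeZero r := ⟨Nat.card_pos.ne'⟩
  let ε : G ⧸ N ≃ Fin r := Finite.equivFin (G ⧸ N)
  let σ : G →* Equiv.Perm (Fin r) :=
    (ε.permCongrHom.toMonoidHom).comp (MulAction.toPermHom G (G ⧸ N))
  let s : Fin r → G := fun j => (ε.symm j).out
  -- The representative of a translated coset differs from the translated representative by an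
  -- element of `N`, which `c` ignores in its second argument.
  have hs : ∀ g j, ∃ u ∈ N, s (σ g j) = g * s j * u := by
    intro g j
    refine ⟨(g * s j)⁻¹ * s (σ g j), ?_, by group⟩
    rw [← QuotientGroup.eq]
    simp [s, σ, Equiv.permCongrHom]
    obtain ⟨y, hy⟩ := QuotientGroup.mk_surjective (ε.symm j)
    rw [← hy]
    rfl
  have hcs : ∀ g h j, c (g, s (σ h j)) = c (g, h * s j) := by
    intro g h j
    obtain ⟨u, hu, h1⟩ := hs h j
    rw [h1, hN _ _ u hu]
  let P : G → GL (Fin r) ℂ := fun g => monomial (σ g) (fun j => c (g, s j))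
  have hP : ∀ g h, P g * P h = Matrix.GeneralLinearGroup.scalar (Fin r) (c (g, h)) * P (g * h) := by
    intro g h
    simp only [P, monomial_mul, scalar_mul_monomial, map_mul, hcs]
    congr 1
    funext j
    -- The cocycle identity at `(g, h, s j)`.
    rw [mul_comm (c (g, h)), hc, mul_comm]
  have hmk : ∀ g h, Matrix.ProjGenLinGroup.mk (P (g * h)) =
      Matrix.ProjGenLinGroup.mk (P g) * Matrix.ProjGenLinGroup.mk (P h) := by
    intro g h
    rw [← map_mul, hP, scalar_comm]
    exact Matrix.ProjGenLinGroup.mk_eq_mk_iff.2 ⟨_, rfl⟩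
  exact ⟨r, this, MonoidHom.mk' (fun g => Matrix.ProjGenLinGroup.mk (P g)) hmk, P, fun _ => rfl,
    fun g h => by rw [hP, mul_inv_cancel_right]⟩

end GoodGroup

/-! ### Reduction to roots of unity, and conclusion. -/

namespace GoodGroup

universe u

variable {G : Type u} [Group G]

/-- Subtracting a coboundary from a 2-cocycle with values in a trivial module gives a 2-cocycle. -/
lemma cocycle_sub_coboundary {A : Type*} [AddCommGroup A] {b c : G → G → A} {z : G → A}
    (hb : ∀ g h j, b (g * h) j + b g h = b h j + b g (h * j))
    (hz : ∀ g h, z h - z (g * h) + z g = b g h - c g h) (g h j : G) :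
    c (g * h) j + c g h = c h j + c g (h * j) := by
  have hc : ∀ g h, c g h = b g h - (z h - z (g * h) + z g) := fun g h => by rw [hz]; abel
  have := hb g h j
  simp only [hc, mul_assoc]
  rw [← sub_eq_zero] at this ⊢
  rw [← this]
  abel

lemma exists_units_pow_eq {n : ℕ} (hn : 0 < n) (x : ℂˣ) : ∃ y : ℂˣ, y ^ n = x := by
  obtain ⟨y, hy⟩ := IsAlgClosed.exists_pow_nat_eq (x : ℂ) hn
  have hy0 : y ≠ 0 := by
    rintro rfl
    rw [zero_pow hn.ne'] at hy
    exact x.ne_zero hy.symm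
  exact ⟨Units.mk0 y hy0, Units.ext (by simpa using hy)⟩

/-- If a multiple `n • b` of a 2-cocycle with values in `ℂˣ` is a coboundary, then `b` differs by
a coboundary from a cocycle with values in the `n`-th roots of unity. -/
lemma exists_rootsOfUnity_cochain {n : ℕ} (hn : 0 < n) {b : G → G → Additive ℂˣ}
    {x : G → Additive ℂˣ} (hx : ∀ g h, x h - x (g * h) + x g = n • b g h) :
    ∃ (c : G → G → Additive (rootsOfUnity n ℂ)) (y : G → Additive ℂˣ), ∀ g h,
      y h - y (g * h) + y g = b g h - (rootsOfUnity n ℂ).subtype.toAdditive (c g h) := by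
  -- Dividing by the coboundary of an `n`-th root of `x` leaves a cochain killed by `n`.
  choose y hy using fun g => exists_units_pow_eq hn (x g).toMul
  have hy' : ∀ g, n • Additive.ofMul (y g) = x g := fun g => hy g
  let Y : G → Additive ℂˣ := fun g => Additive.ofMul (y g)
  have hmem : ∀ g h, (b g h - (Y h - Y (g * h) + Y g)).toMul ∈ rootsOfUnity n ℂ := by
    intro g h
    have : n • (b g h - (Y h - Y (g * h) + Y g)) = 0 := by
      rw [nsmul_sub, nsmul_add, nsmul_sub, hy', hy', hy', hx, sub_self]
    exact this
  refine ⟨fun g h => Additive.ofMul ⟨_, hmem g h⟩, Y, fun g h => ?_⟩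
  exact (sub_sub_cancel (b g h) _).symm

/-- Over a good group, a 2-cocycle with values in a finite trivial module is, up to a coboundary,
invariant under right translation of its second argument by a normal subgroup of finite index. -/
theorem IsGood.exists_factors (hG : IsGood G) {M : Type u} [AddCommGroup M] [Finite M]
    (c : G → G → M)
    (hc : ∀ g h j, c (g * h) j + c g h = c h j + c g (h * j)) :
    ∃ (N : Subgroup G) (_ : N.Normal) (_ : N.FiniteIndex) (d : G → G → M) (e : G → M),
      (∀ g h, e h - e (g * h) + e g = c g h - d g h) ∧ ∀ g h, ∀ u ∈ N, d g (h * u) = d g h := by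
  let _ : TopologicalSpace M := ⊥
  have : DiscreteTopology M := ⟨rfl⟩
  obtain ⟨F, e, he⟩ := hG.exists_continuous_cochain c hc
  obtain ⟨U, hU⟩ := ProfiniteGrp.exists_openNormalSubgroup_mul_invariant
    (ContinuousMap.continuous_uncurry_of_continuous (F 1))
  -- `N` is the preimage of `U` in `G`, and `d(g, h) = F(1, g, gh)`, so translating `h` by `u` on
  -- the right translates only the last variable.
  refine ⟨(U.toFiniteIndexNormalSubgroup.comap (toCompletion G)).toSubgroup, inferInstance,
    inferInstance, _, e, he,
    fun g h u hu => ?_⟩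
  rw [← mul_assoc, map_mul _ (g * h) u]
  exact hU (toCompletion G g) (toCompletion G (g * h)) (toCompletion G u) hu

end GoodGroup

theorem mainTheorem11 (G : Type*) [Group G] (hG : GoodGroup.IsGood G)
    (β : GoodGroup.H2Cx G) (hβ : IsOfFinAddOrder β) :
    ∃ (r : ℕ) (_ : NeZero r), β ∈ Set.range (GoodGroup.coboundary G r) := by
  obtain ⟨n, hn, hnβ⟩ := hβ.exists_nsmul_eq_zero
  obtain ⟨b, rfl⟩ := (ModuleCat.epi_iff_surjective
    (groupCohomology.H2π (GoodGroup.trivialCx G))).1 inferInstance β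
  rw [← map_nsmul, groupCohomology.H2π_eq_zero_iff] at hnβ
  obtain ⟨x, hx⟩ := hnβ
  have hb := (groupCohomology.mem_cocycles₂_iff _).1 b.2
  obtain ⟨c, y, hy⟩ := GoodGroup.exists_rootsOfUnity_cochain hn
    (b := fun g h => (b.1 (g, h)).down) (x := fun g => (x g).down)
    (fun g h => congrArg ULift.down (congrFun hx (g, h)))
  have : NeZero n := ⟨hn.ne'⟩
  let ι := (rootsOfUnity n ℂ).subtype.toAdditive
  have hι : Function.Injective ι := Subtype.val_injective
  have hc := GoodGroup.cocycle_sub_coboundary (fun g h j => congrArg ULift.down (hb g h j)) hy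
  -- `ULift` places the roots of unity in the universe of `G`; the cocycle identity descends to them
  -- because `ι` is injective.
  obtain ⟨N, _, _, d, e, he, hd⟩ := hG.exists_factors
    (fun g h => (ULift.up (c g h) : ULift (Additive (rootsOfUnity n ℂ))))
    (fun g h j => congrArg ULift.up (hι (((map_add ι _ _).trans (hc g h j)).trans (map_add ι _ _).symm)))
  let D : G → G → Additive ℂˣ := fun g h => ι (d g h).down
  -- The two corrections, from `b` to `μ_n` and from there to an `N`-invariant cocycle, add up.
  let z : G → Additive ℂˣ := fun g => y g + ι (e g).down
  have hz : ∀ g h, z h - z (g * h) + z g = (b.1 (g, h)).down - D g h := by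
    intro g h
    have h1 := congrArg (fun m => ι m.down) (he g h)
    simp only [ULift.add_down, ULift.sub_down, map_add, map_sub] at h1
    have h2 := congrArg₂ (· + ·) (hy g h) h1
    refine Eq.trans ?_ (h2.trans (sub_add_sub_cancel _ _ _))
    simp only [z]
    abel
  obtain ⟨r, hr, φ, P, hP, hf⟩ := GoodGroup.exists_isFactorSet_of_factors N
    (fun p => (D p.1 p.2).toMul)
    (GoodGroup.cocycle_sub_coboundary (fun g h j => congrArg ULift.down (hb g h j)) hz)
    (fun g h u hu => congrArg (fun m => (ι m.down).toMul) (hd g h u hu))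
  refine ⟨r, hr, Quotient.mk _ φ, ?_⟩
  rw [GoodGroup.coboundary_mk φ hP hf]
  refine ((groupCohomology.H2π_eq_iff _ _).2 ⟨fun g => ULift.up (z g), ?_⟩).symm
  funext ⟨g, h⟩
  exact congrArg ULift.up (hz g h)
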